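/- Let $p\ge 5$ be a prime and let $g\ge 2$ be an integer. Let $$\Sigma_g=\langle a_1,b_1,\dots,a_g,b_g \mid [a_1,b_1]\cdots[a_g,b_g]\rangle,\qquad [a,b]=aba^{-1}b^{-1},$$ be the surface group of genus $g$, i.e. the fundamental group of a closed oriented surface of genus $g$. Then there exist a finite field extension $K$ of the rational function field $\mathbb{F}_p(x,y)$ in two variables and a faithful representation of $\Sigma_g$ into $\mathrm{PGL}_2(K)=\mathrm{GL}_2(K)/K^\times$, that is, an injective group homomorphism $\Sigma_g\to \mathrm{PGL}_2(K)$. -/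

import Mathlib

/-- The relator `[a₀, b₀] [a₁, b₁] ⋯ [a_{g-1}, b_{g-1}]` in the free group on the `2 g` generators
`aᵢ = (i, false)` and `bᵢ = (i, true)`, where `[a, b] = a b a⁻¹ b⁻¹` and the factors are taken in
increasing order of `i`. -/
def surfaceRelator (g : ℕ) : FreeGroup (Fin g × Bool) :=
  (List.ofFn fun i : Fin g =>
    FreeGroup.of (i, false) * FreeGroup.of (i, true) *
      (FreeGroup.of (i, false))⁻¹ * (FreeGroup.of (i, true))⁻¹).prod

/-- The surface group `Σ_g = ⟨a₀, b₀, …, a_{g-1}, b_{g-1} | [a₀, b₀] ⋯ [a_{g-1}, b_{g-1}]⟩`, the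
fundamental group of a closed oriented surface of genus `g`. -/
abbrev SurfaceGroup (g : ℕ) : Type :=
  PresentedGroup ({surfaceRelator g} : Set (FreeGroup (Fin g × Bool)))

/-- The field `F_p(x, y)` of rational functions in two variables over `F_p`. -/
abbrev RationalFunctionField₂ (p : ℕ) [Fact p.Prime] : Type :=
  FractionRing (MvPolynomial (Fin 2) (ZMod p))

/-! Cut the surface along the curve that separates off the first handle: `SurfaceGroup g` is
generated by the images of two free groups, A (first handle) and B (the rest), in which c, the
relator of A, agrees with d, the inverse relator of B.

Let k be algebraically closed of transcendence degree one over F_p. Both A and B embed in SL₂(k) by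
a ping-pong with leading coefficients (`exists_injective_freeGroup_SL2`). In characteristic p
unipotents are killed by the p-th power while free groups are torsion-free; hence c and d have
transcendental eigenvalues and can be made diagonal (`exists_injective_slDiag`), and any element
triangular in that basis commutes with c, resp. d. The relator generates its own centralizer
(`mem_zpowers_of_commute_surfaceRelator`), so elements outside ⟨c⟩ and ⟨d⟩ have nonzero off-diagonal
entries.

An endomorphism of k carries the eigenvalue of c to that of d (`exists_ringHom_apply_eq`), so the
two representations can be glued. Conjugating that of B by diag(y, y⁻¹), with y transcendental over
k, makes the result faithful modulo scalars (`eq_one_of_twisted_eq_smul_one`). Finitely many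
algebraic matrix entries are involved, so a finite extension of F_p(x, y) suffices. -/

/-! ### The surface relator and its centralizer in the free group -/

/-- The integral Heisenberg group, in coordinates. -/
@[ext] structure Heisenberg where
  x : ℤ
  y : ℤ
  w : ℤ

namespace Heisenberg

instance : Mul Heisenberg := ⟨fun a b => ⟨a.x + b.x, a.y + b.y, a.w + b.w + a.x * b.y⟩⟩
instance : One Heisenberg := ⟨⟨0, 0, 0⟩⟩
instance : Inv Heisenberg := ⟨fun a => ⟨-a.x, -a.y, -a.w + a.x * a.y⟩⟩

@[simp] lemma mul_x (a b : Heisenberg) : (a * b).x = a.x + b.x := rfl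
@[simp] lemma mul_y (a b : Heisenberg) : (a * b).y = a.y + b.y := rfl
@[simp] lemma mul_w (a b : Heisenberg) : (a * b).w = a.w + b.w + a.x * b.y := rfl
@[simp] lemma one_x : (1 : Heisenberg).x = 0 := rfl
@[simp] lemma one_y : (1 : Heisenberg).y = 0 := rfl
@[simp] lemma one_w : (1 : Heisenberg).w = 0 := rfl
@[simp] lemma inv_x (a : Heisenberg) : a⁻¹.x = -a.x := rfl
@[simp] lemma inv_y (a : Heisenberg) : a⁻¹.y = -a.y := rfl
@[simp] lemma inv_w (a : Heisenberg) : a⁻¹.w = -a.w + a.x * a.y := rfl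

instance : Group Heisenberg :=
  Group.ofLeftAxioms (fun a b c => by ext <;> simp <;> ring) (fun a => by ext <;> simp)
    (fun a => by ext <;> simp)

lemma pow_x (a : Heisenberg) (n : ℕ) : (a ^ n).x = n * a.x := by
  induction n with
  | zero => simp
  | succ n ih => rw [pow_succ, mul_x, ih]; push_cast; ring

lemma pow_w (a : Heisenberg) (ha : a.x = 0) (n : ℕ) : (a ^ n).w = n * a.w := by
  induction n with
  | zero => simp
  | succ n ih => rw [pow_succ, mul_w, ih, pow_x, ha]; push_cast; ring

/-- The standard generator of the centre has no proper roots. -/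
lemma eq_one_of_pow_eq {a : Heisenberg} {n : ℕ} (h : a ^ n = ⟨0, 0, 1⟩) : n = 1 := by
  have hn : n ≠ 0 := by
    rintro rfl
    simpa using congrArg Heisenberg.w h
  have hx : a.x = 0 := by
    have := congrArg Heisenberg.x h
    rw [pow_x] at this
    simpa [hn] using this
  have hw := congrArg Heisenberg.w h
  rw [pow_w a hx] at hw
  have : (n : ℤ) ∣ 1 := ⟨_, hw.symm⟩
  exact_mod_cast Int.eq_one_of_dvd_one (by positivity) this

end Heisenberg

lemma lift_surfaceRelator {G : Type*} [Group G] {g : ℕ} (f : Fin g × Bool → G) :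
    FreeGroup.lift f (surfaceRelator g) =
      (List.ofFn fun i : Fin g =>
        f (i, false) * f (i, true) * (f (i, false))⁻¹ * (f (i, true))⁻¹).prod := by
  simp [surfaceRelator, map_list_prod, List.map_ofFn, Function.comp_def]

lemma lift_surfaceRelator_succ {G : Type*} [Group G] {n : ℕ} (f : Fin (n + 1) × Bool → G) :
    FreeGroup.lift f (surfaceRelator (n + 1)) =
      f (0, false) * f (0, true) * (f (0, false))⁻¹ * (f (0, true))⁻¹ *
        FreeGroup.lift (fun q : Fin n × Bool => f (q.1.succ, q.2)) (surfaceRelator n) := by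
  simp only [lift_surfaceRelator, List.ofFn_succ, List.prod_cons]

/-- The first handle goes to the two standard generators, whose commutator is central, and all other
handles go to 1. The central generator has no proper roots, hence neither has the relator. -/
lemma exists_hom_surfaceRelator (n : ℕ) :
    ∃ φ : FreeGroup (Fin (n + 1) × Bool) →* Heisenberg,
      φ (surfaceRelator (n + 1)) = ⟨0, 0, 1⟩ := by
  refine ⟨FreeGroup.lift fun q =>
    if q.1 = 0 then (if q.2 then ⟨0, 1, 0⟩ else ⟨1, 0, 0⟩) else 1, ?_⟩
  rw [lift_surfaceRelator_succ]
  have : FreeGroup.lift (fun _ : Fin n × Bool => (1 : Heisenberg)) = 1 :=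
    FreeGroup.ext_hom _ _ fun _ => by rw [FreeGroup.lift_apply_of, MonoidHom.one_apply]
  simp [Fin.succ_ne_zero, this]
  ext <;> simp

lemma surfaceRelator_ne_one (n : ℕ) : surfaceRelator (n + 1) ≠ 1 := by
  obtain ⟨φ, hφ⟩ := exists_hom_surfaceRelator n
  intro h
  rw [h, map_one] at hφ
  simpa using congrArg Heisenberg.w hφ

/-- By Nielsen–Schreier the subgroup generated by `a` and `b` is free; being abelian, it has rank at
most one. -/
lemma FreeGroup.exists_zpowers_of_commute {α : Type*} {a b : FreeGroup α} (h : Commute a b) :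
    ∃ r, a ∈ Subgroup.zpowers r ∧ b ∈ Subgroup.zpowers r := by
  classical
  let S := Subgroup.closure ({a, b} : Set (FreeGroup α))
  have hS : ∀ x y : S, Commute x y := by
    have := Subgroup.isMulCommutative_closure (k := ({a, b} : Set (FreeGroup α))) (by
      rintro x (rfl | rfl) y (rfl | rfl)
      exacts [rfl, h, h.symm, rfl])
    exact fun x y => mul_comm' x y
  let e := IsFreeGroup.toFreeGroup S
  have hsub : Subsingleton (IsFreeGroup.Generators S) := by
    constructor
    intro i j
    by_contra hij
    have hc : Commute (FreeGroup.of i) (FreeGroup.of j) := by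
      have := (hS (e.symm (FreeGroup.of i)) (e.symm (FreeGroup.of j))).map e
      simpa using this
    -- Two distinct free generators can be sent to non-commuting transpositions of three letters.
    have := congrArg (FreeGroup.lift fun l =>
      if l = i then Equiv.swap (0 : Fin 3) 1 else Equiv.swap 1 2) hc.eq
    simp [Ne.symm hij] at this
    revert this
    decide
  obtain hE | ⟨⟨i⟩⟩ := isEmpty_or_nonempty (IsFreeGroup.Generators S)
  · have h1 : ∀ x : S, x = 1 := fun x => e.injective (Subsingleton.elim _ _)
    refine ⟨1, ?_, ?_⟩
    · have := congrArg Subtype.val (h1 ⟨a, Subgroup.subset_closure (by simp)⟩)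
      simpa using this
    · have := congrArg Subtype.val (h1 ⟨b, Subgroup.subset_closure (by simp)⟩)
      simpa using this
  · have htop : ∀ x : FreeGroup (IsFreeGroup.Generators S), x ∈ Subgroup.zpowers (FreeGroup.of i) := by
      intro x
      induction x using FreeGroup.induction_on with
      | C1 => exact one_mem _
      | of j => rw [Subsingleton.elim j i]; exact Subgroup.mem_zpowers _
      | inv_of j hj => exact inv_mem hj
      | mul x y hx hy => exact mul_mem hx hy
    have key : ∀ x : S, (x : FreeGroup α) ∈
        Subgroup.zpowers ((e.symm (FreeGroup.of i) : S) : FreeGroup α) := by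
      intro x
      obtain ⟨m, hm⟩ := htop (e x)
      refine ⟨m, ?_⟩
      have : e.symm (FreeGroup.of i) ^ m = x := by
        rw [← map_zpow]
        exact e.symm_apply_eq.2 hm
      rw [← this]
      simp
    exact ⟨_, key ⟨a, Subgroup.subset_closure (by simp)⟩,
      key ⟨b, Subgroup.subset_closure (by simp)⟩⟩

/-- The surface relator generates its own centralizer in the free group. -/
lemma mem_zpowers_of_commute_surfaceRelator {n : ℕ} {h : FreeGroup (Fin (n + 1) × Bool)}
    (hc : Commute h (surfaceRelator (n + 1))) : h ∈ Subgroup.zpowers (surfaceRelator (n + 1)) := by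
  obtain ⟨r, hr, m, hm⟩ := FreeGroup.exists_zpowers_of_commute hc
  obtain ⟨φ, hφ⟩ := exists_hom_surfaceRelator n
  have hm' : r ^ m = surfaceRelator (n + 1) := hm
  rw [← hm', map_zpow] at hφ
  rw [← hm']
  obtain ⟨k, rfl | rfl⟩ := m.eq_nat_or_neg
  · rw [zpow_natCast] at hφ
    rw [Heisenberg.eq_one_of_pow_eq hφ]
    simpa using hr
  · rw [zpow_neg, ← inv_zpow, zpow_natCast] at hφ
    rw [Heisenberg.eq_one_of_pow_eq hφ]
    simpa using hr

/-! ### Leading coefficients of matrices polynomial in a transcendental element -/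

section

open Matrix Polynomial

section SL2

variable {K : Type*} [Field K]

/-- The inclusion of `SL₂` into the monoid of matrices. -/
def slMat : SpecialLinearGroup (Fin 2) K →* Matrix (Fin 2) (Fin 2) K where
  toFun A := A.1
  map_one' := rfl
  map_mul' _ _ := rfl

/-- The element of `SL₂` with a given matrix. -/
def slMk (M : Matrix (Fin 2) (Fin 2) K) (h : M.det = 1) : SpecialLinearGroup (Fin 2) K := ⟨M, h⟩

@[simp] lemma slMat_slMk (M : Matrix (Fin 2) (Fin 2) K) (h : M.det = 1) : slMat (slMk M h) = M :=
  rfl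

lemma slMat_injective : Function.Injective (slMat (K := K)) := fun _ _ h => Subtype.ext h

@[simp] lemma det_slMat (A : SpecialLinearGroup (Fin 2) K) : (slMat A).det = 1 := A.2

end SL2

section Lead

variable {k K : Type*} [Field k] [Field K] [Algebra k K]

/-- `M` is the value at `z` of a polynomial matrix of degree at most `d` whose coefficient in
degree `d` is `L`. -/
def HasLead (z : K) (M : Matrix (Fin 2) (Fin 2) K) (d : ℕ) (L : Matrix (Fin 2) (Fin 2) k) : Prop :=
  ∃ P : Matrix (Fin 2) (Fin 2) k[X],
    ∀ i j, M i j = aeval z (P i j) ∧ (P i j).natDegree ≤ d ∧ (P i j).coeff d = L i j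

lemma hasLead_map (z : K) (A : Matrix (Fin 2) (Fin 2) k) :
    HasLead z (A.map (algebraMap k K)) 0 A :=
  ⟨A.map C, fun i j => by simp⟩

lemma HasLead.mul {z : K} {M M' : Matrix (Fin 2) (Fin 2) K} {d d' : ℕ}
    {L L' : Matrix (Fin 2) (Fin 2) k} (h : HasLead z M d L) (h' : HasLead z M' d' L') :
    HasLead z (M * M') (d + d') (L * L') := by
  obtain ⟨P, hP⟩ := h
  obtain ⟨Q, hQ⟩ := h'
  refine ⟨P * Q, fun i j => ?_⟩
  rw [Matrix.mul_apply, Matrix.mul_apply, Matrix.mul_apply]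
  refine ⟨?_, ?_, ?_⟩
  · rw [map_sum]
    refine Finset.sum_congr rfl fun l _ => ?_
    rw [map_mul, (hP i l).1, (hQ l j).1]
  · exact natDegree_sum_le_of_forall_le _ _ fun l _ =>
      natDegree_mul_le_of_le (hP i l).2.1 (hQ l j).2.1
  · rw [finsetSum_coeff]
    refine Finset.sum_congr rfl fun l _ => ?_
    rw [coeff_mul_add_eq_of_natDegree_le (hP i l).2.1 (hQ l j).2.1, (hP i l).2.2, (hQ l j).2.2]

/-- Evaluation at a transcendental `z` is injective, so the polynomial matrix is itself scalar. A
non-scalar leading coefficient thus certifies that a matrix is not scalar. -/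
lemma HasLead.eq_smul_one {z : K} (hz : Transcendental k z) {c : K} {d : ℕ}
    {L : Matrix (Fin 2) (Fin 2) k} (h : HasLead z (c • 1) d L) : ∃ r : k, L = r • 1 := by
  obtain ⟨P, hP⟩ := h
  have inj := transcendental_iff_injective.1 hz
  refine ⟨L 0 0, ?_⟩
  have h01 : P 0 1 = 0 := inj (by rw [← (hP 0 1).1]; simp)
  have h10 : P 1 0 = 0 := inj (by rw [← (hP 1 0).1]; simp)
  have h11 : P 1 1 = P 0 0 := inj (by rw [← (hP 1 1).1, ← (hP 0 0).1]; simp)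
  ext i j
  fin_cases i <;> fin_cases j
  · simp
  · simp [← (hP 0 1).2.2, h01]
  · simp [← (hP 1 0).2.2, h10]
  · simp [← (hP 1 1).2.2, ← (hP 0 0).2.2, h11]

lemma vecMulVec_ne_smul_one {v w : Fin 2 → k} (hv : v ≠ 0) (hw : w ≠ 0) (r : k) :
    vecMulVec v w ≠ r • 1 := by
  intro h
  have hr : r = 0 := by
    have := congrArg det h
    rw [det_vecMulVec, det_smul] at this
    simpa using this.symm
  obtain ⟨i, hi⟩ := Function.ne_iff.1 hv
  obtain ⟨j, hj⟩ := Function.ne_iff.1 hw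
  have := congrFun (congrFun h i) j
  simp [hr, vecMulVec_apply] at this
  tauto

end Lead

/-! ### Free subgroups of SL₂ -/

section FreeRep

variable {k K ι : Type*} [Field k] [Field K] [Algebra k K]

/-- The projection onto the line of slope `a` along the line of slope `b`. -/
def slopeProj (a b : k) : Matrix (Fin 2) (Fin 2) k :=
  vecMulVec ![1, a] ![-b / (a - b), 1 / (a - b)]

/-- The matrix with eigenvalues `z`, `z⁻¹` on the lines of slopes `a`, `b`. -/
def slopeMat (z a b : K) : Matrix (Fin 2) (Fin 2) K :=
  z • slopeProj a b + z⁻¹ • slopeProj b a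

lemma det_slopeMat {z a b : K} (hz : z ≠ 0) (hab : a ≠ b) : (slopeMat z a b).det = 1 := by
  have h1 : a - b ≠ 0 := sub_ne_zero.2 hab
  have h2 : b - a ≠ 0 := sub_ne_zero.2 hab.symm
  simp [slopeMat, slopeProj, det_fin_two]
  field_simp
  ring

lemma slopeMat_mul {z a b : K} (hz : z ≠ 0) (hab : a ≠ b) : slopeMat z a b * slopeMat z b a = 1 := by
  have h1 : a - b ≠ 0 := sub_ne_zero.2 hab
  have h2 : b - a ≠ 0 := sub_ne_zero.2 hab.symm
  ext i j
  fin_cases i <;> fin_cases j <;>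
  · simp [slopeMat, slopeProj, Matrix.mul_apply, Fin.sum_univ_two]
    field_simp
    ring

lemma hasLead_slopeMat {z : K} (hz : z ≠ 0) (a b : k) :
    HasLead z (z • slopeMat z (algebraMap k K a) (algebraMap k K b)) 2 (slopeProj a b) := by
  refine ⟨(slopeProj a b).map (fun c => C c * X ^ 2) + (slopeProj b a).map C, fun i j =>
    ⟨?_, ?_, ?_⟩⟩
  · fin_cases i <;> fin_cases j <;>
    · simp [slopeMat, slopeProj, mul_add, hz]
      ring
  · refine natDegree_add_le_of_degree_le ?_ ?_
    · exact natDegree_C_mul_X_pow_le _ _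
    · simp
  · simp

variable [DecidableEq ι]

/-- The free group on a finite set embeds into `SL₂` of any field which contains a transcendental
element over an infinite subfield. -/
theorem exists_injective_freeGroup_SL2 [Finite ι] [Infinite k] {z : K} (hz : Transcendental k z) :
    ∃ ρ : FreeGroup ι →* SpecialLinearGroup (Fin 2) K, Function.Injective ρ := by
  obtain ⟨f⟩ : Nonempty ((ι × Bool) ↪ k) := by
    have := Fintype.ofFinite ι
    exact ⟨(Fintype.equivFin _).toEmbedding.trans
      ((Fin.valEmbedding).trans (Infinite.natEmbedding k))⟩
  have hz0 : z ≠ 0 := by rintro rfl; exact hz (isAlgebraic_zero)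
  have hne : ∀ i b, f (i, b) ≠ f (i, !b) := fun i b h => by
    have := f.injective h
    simp at this
  have hne' : ∀ i b, algebraMap k K (f (i, b)) ≠ algebraMap k K (f (i, !b)) := fun i b h =>
    hne i b ((algebraMap k K).injective h)
  let m : ι → SpecialLinearGroup (Fin 2) K := fun i =>
    slMk (slopeMat z (algebraMap k K (f (i, true))) (algebraMap k K (f (i, false))))
      (det_slopeMat hz0 (hne' i true))
  refine ⟨FreeGroup.lift m, ?_⟩
  have hletter : ∀ l : ι × Bool, slMat (cond l.2 (m l.1) (m l.1)⁻¹) =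
        slopeMat z (algebraMap k K (f l)) (algebraMap k K (f (l.1, !l.2))) := by
    rintro ⟨i, b⟩
    cases b
    · have hinv : (m i)⁻¹ = slMk (slopeMat z (algebraMap k K (f (i, false)))
          (algebraMap k K (f (i, true)))) (det_slopeMat hz0 (hne' i false)) :=
        inv_eq_of_mul_eq_one_right (slMat_injective (slopeMat_mul hz0 (hne' i true)))
      simp [hinv]
    · simp [m]
  -- The leading coefficient of a word is a product of projections, with image the line of slope `f
  -- l`. It is nonzero because the next letter's line, of slope `f l'`, is not the kernel, of slope
  -- `f (l.1, !l.2)`: this is where reducedness enters.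
  have key : ∀ (l : ι × Bool) (w : List (ι × Bool)), FreeGroup.IsReduced (l :: w) →
      ∃ ψ : Fin 2 → k, ψ ≠ 0 ∧
        HasLead z (z ^ (w.length + 1) • slMat (FreeGroup.lift m (FreeGroup.mk (l :: w)))) (2 * (w.length + 1))
          (vecMulVec ![1, f l] ψ) := by
    intro l w
    induction w generalizing l with
    | nil =>
      intro _
      have hl := hasLead_slopeMat hz0 (f l) (f (l.1, !l.2))
      rw [← hletter, slopeProj] at hl
      refine ⟨_, ?_, by simpa only [FreeGroup.lift_mk, List.map_cons, List.map_nil,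
        List.prod_singleton, List.length_nil, zero_add, pow_one, mul_one] using hl⟩
      intro h
      have := congrFun h 1
      simp [sub_eq_zero, hne l.1 l.2] at this
    | cons l' w ih =>
      intro hw
      rw [FreeGroup.isReduced_cons_cons] at hw
      obtain ⟨ψ, hψ, hl⟩ := ih l' hw.2
      have hmul := (hasLead_slopeMat hz0 (f l) (f (l.1, !l.2))).mul hl
      have hs : f l' ≠ f (l.1, !l.2) := by
        intro h
        have h := f.injective h
        have := hw.1 (by rw [h])
        rw [h] at this
        simp at this
      have hd : f l - f (l.1, !l.2) ≠ 0 := sub_ne_zero.2 (hne l.1 l.2)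
      refine ⟨((f l' - f (l.1, !l.2)) / (f l - f (l.1, !l.2))) • ψ,
        smul_ne_zero (div_ne_zero (sub_ne_zero.2 hs) hd) hψ, ?_⟩
      convert hmul using 1
      · rw [smul_mul_smul_comm, ← pow_succ', ← hletter l, List.length_cons,
          ← map_mul, FreeGroup.lift_mk, FreeGroup.lift_mk, List.map_cons (l := l' :: w),
          List.prod_cons]
      · rw [List.length_cons]; ring
      · rw [slopeProj, vecMulVec_mul_vecMulVec, vecMulVec_smul, vecMulVec_smul]
        refine congrArg (fun s : k => s • vecMulVec ![1, f l] ψ) ?_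
        rw [dotProduct, Fin.sum_univ_two]
        simp
        ring
  rw [injective_iff_map_eq_one]
  intro w hw
  by_contra hne1
  rcases hL : w.toWord with _ | ⟨l, L⟩
  · exact hne1 (FreeGroup.toWord_eq_nil_iff.1 hL)
  · obtain ⟨ψ, hψ, h⟩ := key l L (hL ▸ FreeGroup.isReduced_toWord)
    rw [← hL, FreeGroup.mk_toWord, hw] at h
    obtain ⟨r, hr⟩ := h.eq_smul_one hz
    exact vecMulVec_ne_smul_one (by intro h; simpa using congrFun h 0) hψ r hr

end FreeRep

/-! ### Triangular and diagonalizable elements of SL₂ -/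

section SL2

variable {K : Type*} [Field K]

lemma slMat_inv (A : SpecialLinearGroup (Fin 2) K) :
    slMat A⁻¹ = !![slMat A 1 1, -slMat A 0 1; -slMat A 1 0, slMat A 0 0] :=
  adjugate_fin_two _

lemma slMat_det_eq (A : SpecialLinearGroup (Fin 2) K) :
    slMat A 0 0 * slMat A 1 1 - slMat A 0 1 * slMat A 1 0 = 1 := by
  rw [← det_fin_two, det_slMat]

/-- In characteristic `p`, a matrix `U` with `(U - 1)² = 0` satisfies `U ^ p = 1`. -/
lemma pow_char_eq_one {p : ℕ} [Fact p.Prime] [CharP K p] {U : SpecialLinearGroup (Fin 2) K}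
    (h : (slMat U - 1) ^ 2 = 0) : U ^ p = 1 := by
  apply slMat_injective
  rw [map_pow, map_one, ← sub_eq_zero]
  have h1 := sub_pow_char_of_commute (p := p) (Commute.one_right (slMat U))
  rw [one_pow] at h1
  rw [← h1]
  exact pow_eq_zero_of_le (Fact.out : p.Prime).two_le h

lemma commutator_pow_char_of_upper {p : ℕ} [Fact p.Prime] [CharP K p]
    {A B : SpecialLinearGroup (Fin 2) K} (hA : slMat A 1 0 = 0) (hB : slMat B 1 0 = 0) :
    (A * B * A⁻¹ * B⁻¹) ^ p = 1 := by
  apply pow_char_eq_one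
  have dA := slMat_det_eq A
  have dB := slMat_det_eq B
  rw [hA] at dA
  rw [hB] at dB
  have h00 : (slMat (A * B * A⁻¹ * B⁻¹)) 0 0 = 1 := by
    simp [map_mul, slMat_inv, Matrix.mul_apply, Fin.sum_univ_two, hA, hB]
    linear_combination slMat B 0 0 * slMat B 1 1 * dA + dB
  have h11 : (slMat (A * B * A⁻¹ * B⁻¹)) 1 1 = 1 := by
    simp [map_mul, slMat_inv, Matrix.mul_apply, Fin.sum_univ_two, hA, hB]
    linear_combination slMat B 0 0 * slMat B 1 1 * dA + dB
  have h10 : (slMat (A * B * A⁻¹ * B⁻¹)) 1 0 = 0 := by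
    simp [map_mul, slMat_inv, Matrix.mul_apply, Fin.sum_univ_two, hA, hB]
  generalize slMat (A * B * A⁻¹ * B⁻¹) = U at *
  ext i j
  fin_cases i <;> fin_cases j <;> simp [pow_two, Matrix.mul_apply, Fin.sum_univ_two, h00, h11, h10]

lemma commutator_pow_char_of_lower {p : ℕ} [Fact p.Prime] [CharP K p]
    {A B : SpecialLinearGroup (Fin 2) K} (hA : slMat A 0 1 = 0) (hB : slMat B 0 1 = 0) :
    (A * B * A⁻¹ * B⁻¹) ^ p = 1 := by
  apply pow_char_eq_one
  have dA := slMat_det_eq A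
  have dB := slMat_det_eq B
  rw [hA] at dA
  rw [hB] at dB
  have h00 : (slMat (A * B * A⁻¹ * B⁻¹)) 0 0 = 1 := by
    simp [map_mul, slMat_inv, Matrix.mul_apply, Fin.sum_univ_two, hA, hB]
    linear_combination slMat B 0 0 * slMat B 1 1 * dA + dB
  have h11 : (slMat (A * B * A⁻¹ * B⁻¹)) 1 1 = 1 := by
    simp [map_mul, slMat_inv, Matrix.mul_apply, Fin.sum_univ_two, hA, hB]
    linear_combination slMat B 0 0 * slMat B 1 1 * dA + dB
  have h01 : (slMat (A * B * A⁻¹ * B⁻¹)) 0 1 = 0 := by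
    simp [map_mul, slMat_inv, Matrix.mul_apply, Fin.sum_univ_two, hA, hB]
  generalize slMat (A * B * A⁻¹ * B⁻¹) = U at *
  ext i j
  fin_cases i <;> fin_cases j <;> simp [pow_two, Matrix.mul_apply, Fin.sum_univ_two, h00, h11, h01]

/-- The diagonal matrix with entries `z`, `z⁻¹`. -/
def slDiag (z : Kˣ) : SpecialLinearGroup (Fin 2) K :=
  slMk !![(z : K), 0; 0, ((z⁻¹ : Kˣ) : K)] (by simp [det_fin_two])

lemma slDiag_mul_comm (u z : Kˣ) : slDiag u * slDiag z = slDiag z * slDiag u := by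
  apply slMat_injective
  ext a b
  rw [map_mul, map_mul]
  fin_cases a <;> fin_cases b <;> simp [slDiag, mul_comm]

lemma slMap_injective {K' : Type*} [Field K'] (σ : K →+* K') :
    Function.Injective (SpecialLinearGroup.map (n := Fin 2) σ) := by
  intro A B h
  apply slMat_injective
  ext a b
  exact σ.injective (congrArg (fun M => slMat M a b) h)

lemma map_slDiag {K' : Type*} [Field K'] (σ : K →+* K') (u : Kˣ) :
    SpecialLinearGroup.map σ (slDiag u) = slDiag (Units.map σ.toMonoidHom u) := by
  apply slMat_injective
  ext a b
  change σ (slMat (slDiag u) a b) = _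
  fin_cases a <;> fin_cases b <;> simp [slDiag]

/-- Over an algebraically closed field, an element of `SL₂` is diagonalizable unless its
eigenvalues coincide. -/
lemma exists_conj_slDiag [IsAlgClosed K] (M : SpecialLinearGroup (Fin 2) K) :
    ∃ l : Kˣ, (slMat M - (l : K) • 1) * (slMat M - ((l⁻¹ : Kˣ) : K) • 1) = 0 ∧
      ((l : K) ≠ ((l⁻¹ : Kˣ) : K) → ∃ T, T * M * T⁻¹ = slDiag l) := by
  obtain ⟨l, hl⟩ := IsAlgClosed.exists_root
    (X ^ 2 - C (slMat M 0 0 + slMat M 1 1) * X + 1 : K[X]) (by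
      have : (X ^ 2 - C (slMat M 0 0 + slMat M 1 1) * X + 1 : K[X]).degree = 2 := by
        compute_degree!
      rw [this]; decide)
  simp only [IsRoot, eval_add, eval_sub, eval_mul, eval_pow, eval_X, eval_C, eval_one] at hl
  have dM := slMat_det_eq M
  have hl0 : l ≠ 0 := by rintro rfl; simp at hl
  have hu : l * l⁻¹ = 1 := mul_inv_cancel₀ hl0
  have htr : slMat M 0 0 + slMat M 1 1 = l + l⁻¹ := by
    linear_combination (slMat M 0 0 + slMat M 1 1 - l) * (-hu) - l⁻¹ * hl
  have hdet : ∀ s : K, s * s - (l + l⁻¹) * s + 1 = 0 → (slMat M - s • 1).det = 0 := by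
    intro s hs
    rw [det_fin_two]
    simp
    linear_combination hs + dM - s * htr
  have hdet1 := hdet l (by linear_combination -hu)
  have hdet2 := hdet l⁻¹ (by linear_combination -hu)
  refine ⟨Units.mk0 l hl0, ?_, fun hne => ?_⟩
  -- Cayley–Hamilton, the trace being `l + l⁻¹`.
  · simp only [Units.val_mk0, Units.val_inv_eq_inv_val]
    ext i j
    fin_cases i <;> fin_cases j <;> simp [Matrix.mul_apply, Fin.sum_univ_two]
    · linear_combination -dM + hu + slMat M 0 0 * htr
    · linear_combination slMat M 0 1 * htr
    · linear_combination slMat M 1 0 * htr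
    · linear_combination -dM + hu + slMat M 1 1 * htr
  · simp only [Units.val_mk0, Units.val_inv_eq_inv_val] at hne
    obtain ⟨v, hv0, hv⟩ := exists_mulVec_eq_zero_iff.2 hdet1
    obtain ⟨w, hw0, hw⟩ := exists_mulVec_eq_zero_iff.2 hdet2
    rw [sub_mulVec, smul_mulVec, one_mulVec, sub_eq_zero] at hv hw
    have hP : (!![v 0, w 0; v 1, w 1]).det ≠ 0 := by
      intro h
      obtain ⟨u, hu0, hu⟩ := exists_mulVec_eq_zero_iff.2 h
      have e1 : u 0 • v + u 1 • w = 0 := by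
        ext i
        have := congrFun hu i
        fin_cases i <;> simpa [mulVec, dotProduct, Fin.sum_univ_two, mul_comm (u _)] using this
      have e2 := congrArg (fun x => slMat M *ᵥ x) e1
      simp only [mulVec_add, mulVec_smul, hv, hw, mulVec_zero] at e2
      have e3 : (u 0 * (l - l⁻¹)) • v = 0 := by
        ext i
        have a1 := congrFun e1 i
        have a2 := congrFun e2 i
        simp only [Pi.add_apply, Pi.smul_apply, smul_eq_mul, Pi.zero_apply] at a1 a2 ⊢
        linear_combination a2 - l⁻¹ * a1
      have h0 : u 0 = 0 := by
        simpa [hv0, sub_eq_zero, hne] using e3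
      have h1 : u 1 = 0 := by
        simpa [h0, hw0] using e1
      exact hu0 (by ext i; fin_cases i <;> simp [h0, h1])
    set δ := (!![v 0, w 0; v 1, w 1]).det with hδ
    have hδ' : δ = v 0 * w 1 - w 0 * v 1 := by rw [hδ, det_fin_two]; simp
    -- Rescaling one eigenvector by `δ` puts the change of basis in SL₂.
    let P : SpecialLinearGroup (Fin 2) K := slMk !![v 0 / δ, w 0; v 1 / δ, w 1] (by
      rw [det_fin_two]
      simp
      field_simp
      rw [hδ'])
    refine ⟨P⁻¹, ?_⟩
    rw [inv_inv, mul_assoc, inv_mul_eq_iff_eq_mul]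
    apply slMat_injective
    have v0 := congrFun hv 0
    have v1 := congrFun hv 1
    have w0 := congrFun hw 0
    have w1 := congrFun hw 1
    simp [mulVec, dotProduct, Fin.sum_univ_two] at v0 v1 w0 w1
    ext i j
    fin_cases i <;> fin_cases j <;>
      simp [map_mul, P, slDiag, Matrix.mul_apply, Fin.sum_univ_two]
    · linear_combination δ⁻¹ * v0
    · linear_combination w0
    · linear_combination δ⁻¹ * v1
    · linear_combination w1

end SL2

/-! ### Torsion-free groups in characteristic p -/

section Char

variable {K : Type*} [Field K] {p : ℕ} [Fact p.Prime]

lemma exists_pow_eq_one_of_isAlgebraic_zmod [Algebra (ZMod p) K] {l : K} (hl : l ≠ 0)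
    (h : IsAlgebraic (ZMod p) l) : ∃ m, 0 < m ∧ l ^ m = 1 := by
  have := IntermediateField.adjoin.finiteDimensional h.isIntegral
  have : Finite (IntermediateField.adjoin (ZMod p) {l}) := Module.finite_of_finite (ZMod p)
  let u : (IntermediateField.adjoin (ZMod p) {l})ˣ :=
    Units.mk0 ⟨l, IntermediateField.mem_adjoin_simple_self _ l⟩ (by simpa [Subtype.ext_iff] using hl)
  refine ⟨orderOf u, orderOf_pos u, ?_⟩
  have h1 := congrArg (fun x : (IntermediateField.adjoin (ZMod p) {l})ˣ =>
    ((x : IntermediateField.adjoin (ZMod p) {l}) : K)) (pow_orderOf_eq_one u)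
  rwa [Units.val_pow_eq_pow_val] at h1

/-- Each of `X - a` and `X - b` divides `X ^ m - 1`, so their product divides its square, even if `a
= b`. -/
lemma sq_pow_sub_one_eq_zero {M : Matrix (Fin 2) (Fin 2) K} {a b : K}
    (h : (M - a • 1) * (M - b • 1) = 0) {m : ℕ} (ha : a ^ m = 1) (hb : b ^ m = 1) :
    (M ^ m - 1) ^ 2 = 0 := by
  obtain ⟨q, hq⟩ : X - C a ∣ (X ^ m - 1 : K[X]) := dvd_iff_isRoot.2 (by simp [ha])
  obtain ⟨r, hr⟩ : X - C b ∣ (X ^ m - 1 : K[X]) := dvd_iff_isRoot.2 (by simp [hb])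
  have key : (X ^ m - 1 : K[X]) ^ 2 = (X - C a) * (X - C b) * (q * r) := by
    rw [pow_two]
    nth_rewrite 1 [hq]
    rw [hr]
    ring
  have := congrArg (aeval M) key
  simpa [Algebra.algebraMap_eq_smul_one, h] using this

variable {F : Type*} [Group F] [IsMulTorsionFree F]

/-- An algebraic eigenvalue would be a root of unity, so a power of `ρ c` would be unipotent and `c`
would have finite order. A transcendental eigenvalue differs from its inverse, so `ρ c` is
diagonalizable. -/
lemma exists_injective_slDiag [IsAlgClosed K] [Algebra (ZMod p) K] [CharP K p]
    (ρ : F →* SpecialLinearGroup (Fin 2) K) (hρ : Function.Injective ρ) {c : F} (hc : c ≠ 1) :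
    ∃ (ρ' : F →* SpecialLinearGroup (Fin 2) K) (l : Kˣ), Function.Injective ρ' ∧
      Transcendental (ZMod p) (l : K) ∧ ρ' c = slDiag l := by
  obtain ⟨l, h1, h2⟩ := exists_conj_slDiag (ρ c)
  have hp := (Fact.out : p.Prime)
  have htr : Transcendental (ZMod p) (l : K) := by
    intro hl
    obtain ⟨m, hm, hlm⟩ := exists_pow_eq_one_of_isAlgebraic_zmod l.ne_zero hl
    have hlm' : l ^ m = 1 := Units.ext (by simpa using hlm)
    have h3 := sq_pow_sub_one_eq_zero h1 hlm
      (by rw [← Units.val_pow_eq_pow_val, inv_pow, hlm', inv_one, Units.val_one])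
    rw [← map_pow, ← map_pow] at h3
    have h4 := pow_char_eq_one (p := p) h3
    rw [← map_pow, ← pow_mul] at h4
    have h5 : c ^ (m * p) = 1 := hρ (h4.trans (map_one ρ).symm)
    exact hc ((pow_eq_one_iff_left (Nat.mul_pos hm hp.pos).ne').1 h5)
  have hne : (l : K) ≠ ((l⁻¹ : Kˣ) : K) := by
    intro h
    refine htr (IsAlgebraic.of_pow (n := 2) (by norm_num) ?_)
    have : (l : K) ^ 2 = 1 := by
      rw [pow_two]; nth_rewrite 2 [h]; simp
    rw [this]
    exact isAlgebraic_one
  obtain ⟨T, hT⟩ := h2 hne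
  exact ⟨(MulAut.conj T).toMonoidHom.comp ρ, l, (MulAut.conj T).injective.comp hρ, htr, hT⟩

lemma commute_of_commutator_pow {G : Type*} [Group G] {ρ : F →* G} (hρ : Function.Injective ρ)
    {n : ℕ} (hn : n ≠ 0) {h c : F} (hh : (ρ h * ρ c * (ρ h)⁻¹ * (ρ c)⁻¹) ^ n = 1) :
    Commute h c := by
  have h1 : (h * c * h⁻¹ * c⁻¹) ^ n = 1 := hρ (by simpa using hh)
  rw [pow_eq_one_iff_left hn, mul_inv_eq_one, mul_inv_eq_iff_eq_mul] at h1
  exact h1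

/-- The commutator of two upper triangular matrices is unipotent, hence killed by `p`, hence trivial
in a torsion-free group. -/
lemma commute_of_upper [CharP K p] {ρ : F →* SpecialLinearGroup (Fin 2) K}
    (hρ : Function.Injective ρ) {c : F} {l : Kˣ} (hc : ρ c = slDiag l) {h : F}
    (hh : slMat (ρ h) 1 0 = 0) : Commute h c :=
  commute_of_commutator_pow hρ (Fact.out : p.Prime).ne_zero
    (commutator_pow_char_of_upper hh (by rw [hc]; simp [slDiag]))

lemma commute_of_lower [CharP K p] {ρ : F →* SpecialLinearGroup (Fin 2) K}
    (hρ : Function.Injective ρ) {c : F} {l : Kˣ} (hc : ρ c = slDiag l) {h : F}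
    (hh : slMat (ρ h) 0 1 = 0) : Commute h c :=
  commute_of_commutator_pow hρ (Fact.out : p.Prime).ne_zero
    (commutator_pow_char_of_lower hh (by rw [hc]; simp [slDiag]))

lemma eq_one_of_slMat_eq_smul_one {ρ : F →* SpecialLinearGroup (Fin 2) K}
    (hρ : Function.Injective ρ) {a : F} {s : K} (h : slMat (ρ a) = s • 1) : a = 1 := by
  have hs : s ^ 2 = 1 := by
    have := det_slMat (ρ a)
    rw [h, det_smul] at this
    simpa using this
  have h2 : ρ (a ^ 2) = 1 := slMat_injective (by
    rw [map_pow, map_pow, h, _root_.smul_pow, one_pow, hs, one_smul, map_one])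
  exact (pow_eq_one_iff_left two_ne_zero).1 (hρ (h2.trans (map_one ρ).symm))

end Char

/-! ### Alternating products and Shalen's criterion -/

section Amalgam

variable {A B G : Type*} [Group A] [Group B] [Group G] (i : A →* G) (j : B →* G) (c : A) (d : B)

/-- Products of elements alternately taken from `A \ ⟨c⟩` and `B \ ⟨d⟩`, the first factor being an
arbitrary element of `A` and the last one lying in `B \ ⟨d⟩`. -/
inductive Alternating : G → Prop
  | base (a : A) (b : B) (hb : b ∉ Subgroup.zpowers d) : Alternating (i a * j b)
  | step (g : G) (a : A) (b : B) (hg : Alternating g) (ha : a ∉ Subgroup.zpowers c)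
      (hb : b ∉ Subgroup.zpowers d) : Alternating (g * i a * j b)

variable {i j c d}

/-- The elements of these two shapes are stable under right multiplication by both images. Only
existence of such an expression is needed, not uniqueness. -/
lemma exists_alternating (hcd : i c = j d) (hgen : MonoidHom.mrange i ⊔ MonoidHom.mrange j = ⊤)
    (x : G) : (∃ a, x = i a) ∨ ∃ g a, Alternating i j c d g ∧ x = g * i a := by
  let P : G → Prop := fun x => (∃ a, x = i a) ∨ ∃ g a, Alternating i j c d g ∧ x = g * i a
  have hPA : ∀ x a, P x → P (x * i a) := by
    rintro x a (⟨a', rfl⟩ | ⟨g, a', hg, rfl⟩)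
    · exact .inl ⟨a' * a, by simp⟩
    · exact .inr ⟨g, a' * a, hg, by simp [mul_assoc]⟩
  have hd : ∀ b ∈ Subgroup.zpowers d, ∃ a, j b = i a := by
    rintro _ ⟨m, rfl⟩
    exact ⟨c ^ m, by simp [hcd]⟩
  have hPB : ∀ x b, P x → P (x * j b) := by
    intro x b hx
    by_cases hb : b ∈ Subgroup.zpowers d
    · obtain ⟨a, ha⟩ := hd b hb
      rw [ha]
      exact hPA x a hx
    rcases hx with ⟨a, rfl⟩ | ⟨g, a, hg, rfl⟩
    · exact .inr ⟨_, 1, .base a b hb, by simp⟩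
    by_cases ha : a ∈ Subgroup.zpowers c
    -- An element of `⟨c⟩` is moved across into `B` and merged with the preceding `B`-factor; if the
    -- merged factor falls into `⟨d⟩`, it is absorbed into `A`.
    · obtain ⟨m, rfl⟩ := ha
      have hm : i (c ^ m) * j b = j (d ^ m * b) := by simp [hcd]
      rw [show g * i (c ^ m) * j b = g * j (d ^ m * b) by rw [mul_assoc, hm]]
      generalize d ^ m * b = b'
      cases hg with
      | base a₁ b₁ hb₁ =>
        rw [mul_assoc, ← map_mul]
        by_cases h : b₁ * b' ∈ Subgroup.zpowers d
        · obtain ⟨a₂, ha₂⟩ := hd _ h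
          exact .inl ⟨a₁ * a₂, by rw [ha₂, map_mul]⟩
        · exact .inr ⟨_, 1, .base a₁ _ h, by simp⟩
      | step g₁ a₁ b₁ hg₁ ha₁ hb₁ =>
        rw [mul_assoc, ← map_mul]
        by_cases h : b₁ * b' ∈ Subgroup.zpowers d
        · obtain ⟨a₂, ha₂⟩ := hd _ h
          exact .inr ⟨g₁, a₁ * a₂, hg₁, by rw [ha₂, map_mul, mul_assoc]⟩
        · exact .inr ⟨_, 1, .step g₁ a₁ _ hg₁ ha₁ h, by simp⟩
    · exact .inr ⟨_, 1, .step g a b hg ha hb, by simp⟩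
  let S : Submonoid G :=
    { carrier := {y | ∀ x, P x → P (x * y)}
      one_mem' := fun x hx => by rwa [mul_one]
      mul_mem' := fun {y z} hy hz x hx => by
        rw [← mul_assoc]
        exact hz _ (hy _ hx) }
  have hS : MonoidHom.mrange i ⊔ MonoidHom.mrange j ≤ S := by
    apply sup_le
    · rintro _ ⟨a, rfl⟩ x hx
      exact hPA x a hx
    · rintro _ ⟨b, rfl⟩ x hx
      exact hPB x b hx
  have hx : x ∈ S := hS (hgen ▸ Submonoid.mem_top x)
  have := hx 1 (.inl ⟨1, by simp⟩)
  rwa [one_mul] at this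

variable {k K : Type*} [Field k] [Field K] [Algebra k K]

/-- Conjugation scales the upper right entry by `z²` and the lower left by `z⁻²`. The factor `z²`
clears the pole, and degree 4 sees only the upper right entry. -/
lemma hasLead_conj_slDiag (z : Kˣ) (M : SpecialLinearGroup (Fin 2) k) :
    HasLead (z : K) ((z : K) ^ 2 • slMat (slDiag z *
      SpecialLinearGroup.map (algebraMap k K) M * (slDiag z)⁻¹)) 4
      (vecMulVec ![slMat M 0 1, 0] ![0, 1]) := by
  have hm : slMat (SpecialLinearGroup.map (algebraMap k K) M) =
      !![algebraMap k K (slMat M 0 0), algebraMap k K (slMat M 0 1);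
        algebraMap k K (slMat M 1 0), algebraMap k K (slMat M 1 1)] :=
    eta_fin_two _
  refine ⟨!![C (slMat M 0 0) * X ^ 2, C (slMat M 0 1) * X ^ 4;
    C (slMat M 1 0), C (slMat M 1 1) * X ^ 2], fun i j => ?_⟩
  rw [map_mul, map_mul, slMat_inv, hm]
  have hz : (z : K) ≠ 0 := z.ne_zero
  refine ⟨?_, ?_, ?_⟩
  · fin_cases i <;> fin_cases j <;>
    · simp [slDiag]
      try field_simp
  · fin_cases i <;> fin_cases j <;> simp <;> compute_degree!
  · fin_cases i <;> fin_cases j <;> simp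

/-- Shalen's criterion: let `G` be generated by images of `A` and `B` in which `c` and `d` agree,
and let `A` and `B` be represented in `SL₂` so that an element outside `⟨c⟩`, resp. `⟨d⟩`, has a
nonzero lower left, resp. upper right, entry. Then twisting the second representation by a
transcendental diagonal matrix gives a representation of `G` which is faithful modulo scalars. -/
theorem eq_one_of_twisted_eq_smul_one (hcd : i c = j d)
    (hgen : MonoidHom.mrange i ⊔ MonoidHom.mrange j = ⊤)
    {ρA : A →* SpecialLinearGroup (Fin 2) k} {ρB : B →* SpecialLinearGroup (Fin 2) k}
    (hA : ∀ a, slMat (ρA a) 1 0 = 0 → a ∈ Subgroup.zpowers c)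
    (hB : ∀ b, slMat (ρB b) 0 1 = 0 → b ∈ Subgroup.zpowers d)
    (hA1 : ∀ a (s : k), slMat (ρA a) = s • 1 → a = 1)
    {z : Kˣ} (hz : Transcendental k (z : K)) {ρ : G →* SpecialLinearGroup (Fin 2) K}
    (hi : ∀ a, ρ (i a) = SpecialLinearGroup.map (algebraMap k K) (ρA a))
    (hj : ∀ b, ρ (j b) = slDiag z * SpecialLinearGroup.map (algebraMap k K) (ρB b) * (slDiag z)⁻¹)
    {x : G} {s : K} (hx : slMat (ρ x) = s • 1) : x = 1 := by
  have leadA : ∀ a, HasLead (z : K) (slMat (ρ (i a))) 0 (slMat (ρA a)) := fun a => by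
    rw [hi]
    exact hasLead_map _ _
  have leadB : ∀ b, HasLead (z : K) ((z : K) ^ 2 • slMat (ρ (j b))) 4
      (vecMulVec ![slMat (ρB b) 0 1, 0] ![0, 1]) := fun b => by
    rw [hj]
    exact hasLead_conj_slDiag _ _
  -- Leading coefficients stay of rank one: each step multiplies by the lower left entry of `ρA a`
  -- times the upper right entry of `ρB b`, both nonzero.
  have key : ∀ g, Alternating i j c d g → ∃ (n m : ℕ) (v : Fin 2 → k), v ≠ 0 ∧
      HasLead (z : K) ((z : K) ^ n • slMat (ρ g)) m (vecMulVec v ![0, 1]) := by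
    intro g hg
    induction hg with
    | base a b hb =>
      refine ⟨2, 0 + 4, slMat (ρA a) *ᵥ ![slMat (ρB b) 0 1, 0], ?_, ?_⟩
      · intro h
        have := eq_zero_of_mulVec_eq_zero (by simp) h
        exact hb (hB b (by simpa using congrFun this 0))
      · have := (leadA a).mul (leadB b)
        rwa [mul_vecMulVec, mul_smul_comm, ← map_mul, ← map_mul] at this
    | step g a b hg ha hb ih =>
      obtain ⟨n, m, v, hv, h⟩ := ih
      have := (h.mul (leadA a)).mul (leadB b)
      refine ⟨n + 2, m + 0 + 4, (slMat (ρA a) 1 0 * slMat (ρB b) 0 1) • v, smul_ne_zero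
        (mul_ne_zero (fun h => ha (hA a h)) (fun h => hb (hB b h))) hv, ?_⟩
      convert this using 1
      · rw [map_mul, map_mul, map_mul, map_mul, smul_mul_assoc, smul_mul_smul_comm, pow_add]
      · rw [vecMulVec_mul, vecMulVec_mul_vecMulVec, vecMulVec_smul, smul_vecMulVec]
        congr 1
        simp [dotProduct, vecMul, Fin.sum_univ_two]
  rcases exists_alternating hcd hgen x with ⟨a, rfl⟩ | ⟨g, a, hg, rfl⟩
  · have h := leadA a
    rw [hx] at h
    obtain ⟨r, hr⟩ := h.eq_smul_one hz
    rw [hA1 a r hr, map_one]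
  · obtain ⟨n, m, v, hv, h⟩ := key g hg
    have h1 := h.mul (leadA a)
    rw [smul_mul_assoc, ← map_mul, ← map_mul, hx, smul_smul, vecMulVec_mul] at h1
    obtain ⟨r, hr⟩ := h1.eq_smul_one hz
    refine absurd hr (vecMulVec_ne_smul_one hv (fun h0 => ?_) r)
    have := eq_zero_of_vecMul_eq_zero (by simp) h0
    simpa using congrFun this 1

end Amalgam

/-! ### Fields of transcendence degree one -/

section Fields

open scoped IntermediateField.algebraAdjoinAdjoin

/-- Each of `l` and `m` is a transcendence basis, so `k` is an algebraic closure over both `F[l]`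
and `F[m]`, and the isomorphism `l ↦ m` extends. -/
lemma exists_ringHom_apply_eq {F k : Type} [Field F] [Field k] [Algebra F k] [IsAlgClosed k]
    (htr : Algebra.trdeg F k ≤ 1) {l m : k} (hl : Transcendental F l) (hm : Transcendental F m) :
    ∃ φ : k →+* k, φ l = m := by
  have basis : ∀ {x : k}, Transcendental F x → IsTranscendenceBasis F fun _ : Unit => x :=
    fun hx => (algebraicIndependent_unique_type_iff.2 hx).isTranscendenceBasis_of_trdeg_le_of_finite
      (by simpa using htr)
  have bl := basis hl
  have bm := basis hm
  have := IsAlgClosed.isAlgClosure_of_transcendence_basis _ bl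
  have := IsAlgClosed.isAlgClosure_of_transcendence_basis _ bm
  let e := (bl.1.aevalEquiv.symm.trans bm.1.aevalEquiv).toRingEquiv
  refine ⟨(IsAlgClosure.equivOfEquiv k k e).toRingHom, ?_⟩
  have h := IsAlgClosure.equivOfEquiv_algebraMap k k e (bl.1.aevalEquiv (MvPolynomial.X ()))
  have h1 : algebraMap _ k (bl.1.aevalEquiv (MvPolynomial.X ())) = l := by simp
  have h2 : algebraMap _ k (e (bl.1.aevalEquiv (MvPolynomial.X ()))) = m := by simp [e]
  rw [h1, h2] at h
  exact h

lemma trdeg_eq_of_isAlgebraic {F L k : Type} [Field F] [CommRing L] [IsDomain L] [Field k]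
    [Algebra F L] [Algebra L k] [FaithfulSMul L k] [Algebra F k] [IsScalarTower F L k]
    [Algebra.IsAlgebraic L k] : Algebra.trdeg F k = Algebra.trdeg F L := by
  rw [← trdeg_add_eq F L (A := k), trdeg_eq_zero (R := L), add_zero]

/-- The field is the algebraic closure of `F(x)` in `Ω`; `y` stays transcendental over an algebraic
extension. -/
lemma exists_isAlgClosed_trdeg_le_one (F Ω : Type) [Field F] [Field Ω] [Algebra F Ω]
    [IsAlgClosed Ω] {x y : Ω} (h : AlgebraicIndependent F ![x, y]) :
    ∃ (k : Type) (_ : Field k) (_ : IsAlgClosed k) (_ : Algebra F k) (_ : Algebra k Ω),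
      Algebra.trdeg F k ≤ 1 ∧ (∃ x : k, Transcendental F x) ∧ ∃ y : Ω, Transcendental k y := by
  let L := IntermediateField.adjoin F {x}
  have hy : Transcendental L y := by
    rw [IntermediateField.transcendental_adjoin_iff]
    have := (AlgebraicIndependent.iff_transcendental_adjoin_image (1 : Fin 2)).1 h
    have him : ![x, y] '' {1}ᶜ = {x} := by
      have : ({1}ᶜ : Set (Fin 2)) = {0} := by ext i; fin_cases i <;> simp
      rw [this, Set.image_singleton]
      rfl
    rw [him] at this
    exact this.2
  have hsurj : Function.Surjective ((aeval x : F[X] →ₐ[F] Ω).codRestrict (Algebra.adjoin F {x})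
      fun f => by rw [Algebra.adjoin_singleton_eq_range_aeval]; exact ⟨f, rfl⟩) := by
    rintro ⟨w, hw⟩
    rw [Algebra.adjoin_singleton_eq_range_aeval] at hw
    obtain ⟨f, rfl⟩ := hw
    exact ⟨f, rfl⟩
  have htr : Algebra.trdeg F L ≤ 1 := by
    rw [trdeg_eq_of_isAlgebraic (L := Algebra.adjoin F {x}),
      ← Polynomial.trdeg_of_isDomain (R := F)]
    exact trdeg_le_of_surjective _ hsurj
  have : IsScalarTower F L (algebraicClosure L Ω) := .of_algebraMap_eq' rfl
  have : FaithfulSMul L (algebraicClosure L Ω) :=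
    (faithfulSMul_iff_algebraMap_injective _ _).2 (algebraMap L (algebraicClosure L Ω)).injective
  refine ⟨algebraicClosure L Ω, inferInstance,
    (algebraicClosure.isAlgClosure L Ω).isAlgClosed, inferInstance, inferInstance,
    trdeg_eq_of_isAlgebraic.trans_le htr, ?_, y, hy.algebraicClosure⟩
  refine ⟨algebraMap L _ ⟨x, IntermediateField.mem_adjoin_simple_self _ x⟩, ?_⟩
  rw [transcendental_algebraMap_iff (algebraMap L (algebraicClosure L Ω)).injective,
    ← transcendental_algebraMap_iff (algebraMap L Ω).injective]
  exact h.transcendental 0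

end Fields

/-! ### Descent to a finite extension -/

section Descent

/-- A representation of a finitely generated group over an algebraic extension is defined over a
finite extension. -/
lemma exists_finiteDimensional_descent {R Ω : Type} [Field R] [Field Ω] [Algebra R Ω]
    [Algebra.IsAlgebraic R Ω] {α : Type*} [Finite α] {rels : Set (FreeGroup α)}
    (ρ : PresentedGroup rels →* SpecialLinearGroup (Fin 2) Ω) :
    ∃ (K : IntermediateField R Ω) (ρ' : PresentedGroup rels →* SpecialLinearGroup (Fin 2) K),
      FiniteDimensional R K ∧ ∀ x, SpecialLinearGroup.map (algebraMap K Ω) (ρ' x) = ρ x := by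
  let S : Set Ω := Set.range fun q : α × Fin 2 × Fin 2 =>
    slMat (ρ (PresentedGroup.of q.1)) q.2.1 q.2.2
  let K := IntermediateField.adjoin R S
  have hS : ∀ q a b, slMat (ρ (PresentedGroup.of q)) a b ∈ K := fun q a b =>
    IntermediateField.subset_adjoin _ _ ⟨(q, a, b), rfl⟩
  have hmap := slMap_injective (algebraMap K Ω)
  let M : α → Matrix (Fin 2) (Fin 2) K := fun q => Matrix.of fun a b => ⟨_, hS q a b⟩
  have hM : ∀ q, (M q).map (algebraMap K Ω) = slMat (ρ (PresentedGroup.of q)) := fun q => rfl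
  have hdet : ∀ q, (M q).det = 1 := fun q => by
    apply (algebraMap K Ω).injective
    rw [RingHom.map_det, map_one, RingHom.mapMatrix_apply, hM, det_slMat]
  let f : α → SpecialLinearGroup (Fin 2) K := fun q => slMk (M q) (hdet q)
  have hf : (SpecialLinearGroup.map (algebraMap K Ω)).comp (FreeGroup.lift f) =
      ρ.comp (PresentedGroup.mk rels) :=
    FreeGroup.ext_hom _ _ fun q => by
      rw [MonoidHom.comp_apply, FreeGroup.lift_apply_of]
      exact slMat_injective (hM q)
  -- The relations hold over `K` because they hold over `Ω` and SL₂ over `K` embeds there.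
  have hrel : ∀ r ∈ rels, FreeGroup.lift f r = 1 := fun r hr => by
    apply hmap
    have := DFunLike.congr_fun hf r
    rw [MonoidHom.comp_apply, MonoidHom.comp_apply, PresentedGroup.one_of_mem hr] at this
    rw [this, map_one, map_one]
  refine ⟨K, PresentedGroup.toGroup hrel, ?_, fun x => ?_⟩
  · exact IntermediateField.finiteDimensional_adjoin fun s _ => Algebra.IsIntegral.isIntegral s
  · induction x with
    | H w => exact DFunLike.congr_fun hf w

end Descent

end

/-! ### Representations of surface groups -/

section Surface

lemma lift_surfaceRelator_eq_mul {H : Type*} [Group H] {n : ℕ} {f : Fin (n + 1) × Bool → H}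
    {ψ₁ : FreeGroup (Fin 1 × Bool) →* H} {ψ₂ : FreeGroup (Fin n × Bool) →* H}
    (h₁ : ∀ b, f (0, b) = ψ₁ (FreeGroup.of (0, b)))
    (h₂ : ∀ i b, f (Fin.succ i, b) = ψ₂ (FreeGroup.of (i, b))) :
    FreeGroup.lift f (surfaceRelator (n + 1)) =
      ψ₁ (surfaceRelator 1) * ψ₂ (surfaceRelator n) := by
  have e₂ : FreeGroup.lift (fun q : Fin n × Bool => f (q.1.succ, q.2)) = ψ₂ :=
    FreeGroup.ext_hom _ _ fun q => by rw [FreeGroup.lift_apply_of, h₂]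
  rw [lift_surfaceRelator_succ, e₂]
  simp [surfaceRelator, h₁]

variable {k Ω : Type} [Field k] [IsAlgClosed k] {p : ℕ} [Fact p.Prime] [Algebra (ZMod p) k]

/-- The ping-pong needs infinitely many slopes, so the base is enlarged from F_p to its algebraic
closure in `k`, over which `x` stays transcendental. -/
lemma exists_injective_freeGroup_of_trdeg {x : k} (hx : Transcendental (ZMod p) x)
    (ι : Type*) [Finite ι] :
    ∃ ρ : FreeGroup ι →* Matrix.SpecialLinearGroup (Fin 2) k, Function.Injective ρ := by
  classical
  have := (algebraicClosure.isAlgClosure (ZMod p) k).isAlgClosed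
  exact exists_injective_freeGroup_SL2 hx.algebraicClosure

/-- The surface group has a representation in `SL₂` which is faithful modulo scalars, over any field
containing a transcendental element over an algebraically closed field of transcendence degree
one over the prime field. -/
theorem exists_surfaceGroup_SL2 [Field Ω] [Algebra k Ω] (htr : Algebra.trdeg (ZMod p) k ≤ 1)
    {x : k} (hx : Transcendental (ZMod p) x) {y : Ω} (hy : Transcendental k y) (n : ℕ) :
    ∃ ρ : SurfaceGroup (n + 2) →* Matrix.SpecialLinearGroup (Fin 2) Ω,
      ∀ w (s : Ω), slMat (ρ w) = s • 1 → w = 1 := by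
  have : CharP k p := charP_of_injective_algebraMap (algebraMap (ZMod p) k).injective p
  obtain ⟨ρ₁, h₁⟩ := exists_injective_freeGroup_of_trdeg hx (Fin 1 × Bool)
  obtain ⟨ρ₂, h₂⟩ := exists_injective_freeGroup_of_trdeg hx (Fin (n + 1) × Bool)
  obtain ⟨ρ₁, l, h₁, hl, hl₁⟩ :=
    exists_injective_slDiag (p := p) ρ₁ h₁ (surfaceRelator_ne_one 0)
  obtain ⟨ρB, m, hB, hm, hmB⟩ :=
    exists_injective_slDiag (p := p) ρ₂ h₂ (inv_ne_one.2 (surfaceRelator_ne_one n))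
  obtain ⟨φ, hφ⟩ := exists_ringHom_apply_eq htr hl hm
  let ρA := (Matrix.SpecialLinearGroup.map φ).comp ρ₁
  have hφl : Units.map φ.toMonoidHom l = m := Units.ext hφ
  have hmA : ρA (surfaceRelator 1) = slDiag m := by
    rw [MonoidHom.comp_apply, hl₁, map_slDiag, hφl]
  have hA : Function.Injective ρA := (slMap_injective φ).comp h₁
  have hy0 : y ≠ 0 := by rintro rfl; exact hy isAlgebraic_zero
  let z : Ωˣ := Units.mk0 y hy0
  let σ := Matrix.SpecialLinearGroup.map (n := Fin 2) (algebraMap k Ω)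
  let ψA := σ.comp ρA
  let ψB := (MulAut.conj (slDiag z)).toMonoidHom.comp (σ.comp ρB)
  let f : Fin (n + 2) × Bool → Matrix.SpecialLinearGroup (Fin 2) Ω := fun q =>
    Fin.cases (ψA (FreeGroup.of (0, q.2))) (fun i => ψB (FreeGroup.of (i, q.2))) q.1
  have hrel : ∀ r ∈ ({surfaceRelator (n + 2)} : Set (FreeGroup (Fin (n + 2) × Bool))),
      FreeGroup.lift f r = 1 := by
    rintro r rfl
    rw [lift_surfaceRelator_eq_mul (ψ₁ := ψA) (ψ₂ := ψB) (fun b => rfl) (fun i b => rfl),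
      mul_eq_one_iff_eq_inv, ← map_inv]
    change σ (ρA _) = slDiag z * σ (ρB _) * (slDiag z)⁻¹
    -- The twist by `slDiag z` fixes the common diagonal image of `c` and `d`, so gluing survives
    -- it.
    rw [hmA, hmB, eq_mul_inv_iff_mul_eq, map_slDiag]
    exact slDiag_mul_comm _ _
  let ρ : SurfaceGroup (n + 2) →* Matrix.SpecialLinearGroup (Fin 2) Ω := PresentedGroup.toGroup hrel
  let i : FreeGroup (Fin 1 × Bool) →* SurfaceGroup (n + 2) :=
    FreeGroup.lift fun q => PresentedGroup.of (0, q.2)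
  let j : FreeGroup (Fin (n + 1) × Bool) →* SurfaceGroup (n + 2) :=
    FreeGroup.lift fun q => PresentedGroup.of (q.1.succ, q.2)
  have hi : ρ.comp i = ψA := FreeGroup.ext_hom _ _ fun ⟨q, b⟩ => by
    rw [Subsingleton.elim q 0, MonoidHom.comp_apply, FreeGroup.lift_apply_of]
    exact PresentedGroup.toGroup.of hrel
  have hj : ρ.comp j = ψB := FreeGroup.ext_hom _ _ fun q => by
    rw [MonoidHom.comp_apply, FreeGroup.lift_apply_of]
    exact PresentedGroup.toGroup.of hrel
  have hij : i (surfaceRelator 1) = j (surfaceRelator (n + 1))⁻¹ := by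
    rw [map_inv, ← mul_eq_one_iff_eq_inv, ← lift_surfaceRelator_eq_mul
      (f := fun q => (PresentedGroup.of q : SurfaceGroup (n + 2))) (fun b => ?_) (fun q b => ?_)]
    · have : FreeGroup.lift (fun q => (PresentedGroup.of q : SurfaceGroup (n + 2))) =
          PresentedGroup.mk _ := FreeGroup.ext_hom _ _ fun q => FreeGroup.lift_apply_of ..
      rw [this]
      exact PresentedGroup.one_of_mem rfl
    · rw [FreeGroup.lift_apply_of]
    · rw [FreeGroup.lift_apply_of]
  have hgen : MonoidHom.mrange i ⊔ MonoidHom.mrange j = ⊤ := by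
    have hof : ∀ q, ∀ t : FreeGroup (Fin (n + 2) × Bool), (t = FreeGroup.of q ∨
        t = (FreeGroup.of q)⁻¹) → (PresentedGroup.mk _ t : SurfaceGroup (n + 2)) ∈
          MonoidHom.mrange i ⊔ MonoidHom.mrange j := by
      rintro ⟨q, b⟩
      induction q using Fin.cases with
      | zero =>
        have e : i (FreeGroup.of (0, b)) = PresentedGroup.mk _ (FreeGroup.of (0, b)) :=
          FreeGroup.lift_apply_of ..
        rintro t (rfl | rfl)
        · exact Submonoid.mem_sup_left ⟨_, e⟩
        · exact Submonoid.mem_sup_left ⟨(FreeGroup.of (0, b))⁻¹, by rw [map_inv, e, map_inv]⟩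
      | succ q =>
        have e : j (FreeGroup.of (q, b)) = PresentedGroup.mk _ (FreeGroup.of (q.succ, b)) :=
          FreeGroup.lift_apply_of ..
        rintro t (rfl | rfl)
        · exact Submonoid.mem_sup_right ⟨_, e⟩
        · exact Submonoid.mem_sup_right ⟨(FreeGroup.of (q, b))⁻¹, by rw [map_inv, e, map_inv]⟩
    rw [eq_top_iff]
    rintro w -
    induction w using PresentedGroup.induction_on with
    | _ t =>
      induction t using FreeGroup.induction_on with
      | C1 => rw [map_one]; exact one_mem _
      | of q => exact hof q _ (.inl rfl)
      | inv_of q _ => exact hof q _ (.inr rfl)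
      | mul s t hs ht => rw [map_mul]; exact mul_mem hs ht
  refine ⟨ρ, fun w s hw => eq_one_of_twisted_eq_smul_one hij hgen (ρA := ρA) (ρB := ρB)
    (fun a ha => mem_zpowers_of_commute_surfaceRelator (commute_of_upper (p := p) hA hmA ha))
    (fun b hb => ?_) (fun a s ha => eq_one_of_slMat_eq_smul_one hA ha) (z := z) hy
    (fun a => DFunLike.congr_fun hi a) (fun b => DFunLike.congr_fun hj b) hw⟩
  rw [Subgroup.zpowers_inv]
  exact mem_zpowers_of_commute_surfaceRelator
    ((Commute.inv_right_iff).1 (commute_of_lower (p := p) hB hmB hb))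

end Surface

/-! ### Passage to PGL₂ -/

theorem mainTheorem1 (p : ℕ) [Fact p.Prime] (hp : 5 ≤ p) (g : ℕ) (hg : 2 ≤ g) :
    ∃ (K : Type) (_ : Field K) (_ : Algebra (RationalFunctionField₂ p) K),
      FiniteDimensional (RationalFunctionField₂ p) K ∧
        ∃ ρ : SurfaceGroup g →* Matrix.ProjGenLinGroup (Fin 2) K, Function.Injective ρ := by
  obtain ⟨n, rfl⟩ := Nat.exists_eq_add_of_le' hg
  let Ω := AlgebraicClosure (RationalFunctionField₂ p)
  have hind : AlgebraicIndependent (ZMod p)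
      ![algebraMap (MvPolynomial (Fin 2) (ZMod p)) Ω (MvPolynomial.X 0),
        algebraMap (MvPolynomial (Fin 2) (ZMod p)) Ω (MvPolynomial.X 1)] := by
    have hinj : Function.Injective (algebraMap (MvPolynomial (Fin 2) (ZMod p)) Ω) :=
      (algebraMap (RationalFunctionField₂ p) Ω).injective.comp
        (IsFractionRing.injective (MvPolynomial (Fin 2) (ZMod p)) (RationalFunctionField₂ p))
    have := (MvPolynomial.algebraicIndependent_X (Fin 2) (ZMod p)).map'
      (f := IsScalarTower.toAlgHom (ZMod p) (MvPolynomial (Fin 2) (ZMod p)) Ω) hinj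
    convert this using 1
    ext q
    fin_cases q <;> rfl
  obtain ⟨k, _, _, _, _, htr, ⟨x, hx⟩, y, hy⟩ := exists_isAlgClosed_trdeg_le_one (ZMod p) Ω hind
  obtain ⟨ρ, hρ⟩ := exists_surfaceGroup_SL2 htr hx hy n
  obtain ⟨K, ρ', hK, hρ'⟩ := exists_finiteDimensional_descent (R := RationalFunctionField₂ p) ρ
  refine ⟨K, inferInstance, inferInstance, hK, Matrix.SpecialLinearGroup.toPGL.comp ρ', ?_⟩
  rw [injective_iff_map_eq_one]
  intro w hw
  -- The kernel of SL₂ → PGL₂ is the centre, which consists of scalars; faithfulness modulo scalars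
  -- over `Ω` then applies.
  have hc : ρ' w ∈ Subgroup.center (Matrix.SpecialLinearGroup (Fin 2) K) := by
    rw [← Matrix.SpecialLinearGroup.toPGL_ker]
    exact hw
  obtain ⟨r, -, hr⟩ := Matrix.SpecialLinearGroup.mem_center_iff.1 hc
  refine hρ w (algebraMap K Ω r) ?_
  rw [← hρ']
  change (slMat (ρ' w)).map (algebraMap K Ω) = _
  rw [show slMat (ρ' w) = Matrix.scalar (Fin 2) r from hr.symm]
  ext a b
  fin_cases a <;> fin_cases b <;> simp
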